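/- Let $H$ be an infinite-dimensional complex Hilbert space (not necessarily separable) and let $T$ be a bounded linear operator on $H$. For a bounded operator $S\colon H_1\to H_2$ between complex inner product spaces put $m(S)=\inf\{\|Sx\| : x\in H_1,\ \|x\|=1\}$; $S$ is called minimum attaining if $\|Sx_0\|=m(S)$ for some $x_0 \in H_1$ with $\|x_0\|=1$. The operator $T$ is called absolutely minimum attaining if the restriction $T|_M\colon M\to H$ is minimum attaining for every nonzero closed subspace $M$ of $H$. An operator $A$ on $H$ is called positive if $A^*=A$ and $\langle Ax,x\rangle\ge 0$ for all $x\in H$, and it has finite rank if its range is finite-dimensional. Then the following are equivalent: 1. $T$ is positive and absolutely minimum attaining; 2. there exist a real number $\alpha$, a positive compact operator $K$ on $H$ with $\|K\|\le\alpha$, and a positive finite rank operator $F$ on $H$ with $KF=FK=0$, such that $T=\alpha I-K+F$. Moreover, the decomposition is unique: if $(\alpha,K,F)$ and $(\alpha',K',F')$ are two triples as in (2) for the same operator $T$, then $\alpha=\alpha'$, $K=K'$ and $F=F'$. -/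

import Mathlib

/-- The minimum modulus `m(T) = inf {‖T x‖ : ‖x‖ = 1}` of a bounded operator. -/
noncomputable def minimumModulus {E F : Type*} [NormedAddCommGroup E] [InnerProductSpace ℂ E]
    [NormedAddCommGroup F] [InnerProductSpace ℂ F] (T : E →L[ℂ] F) : ℝ :=
  sInf {r : ℝ | ∃ x : E, ‖x‖ = 1 ∧ r = ‖T x‖}

/-- `T` is minimum attaining if `‖T x₀‖ = m(T)` for some unit vector `x₀`. -/
def IsMinimumAttaining {E F : Type*} [NormedAddCommGroup E] [InnerProductSpace ℂ E]
    [NormedAddCommGroup F] [InnerProductSpace ℂ F] (T : E →L[ℂ] F) : Prop :=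
  ∃ x₀ : E, ‖x₀‖ = 1 ∧ ‖T x₀‖ = minimumModulus T

/-- `T` is absolutely minimum attaining if its restriction to every nonzero closed subspace
is minimum attaining. -/
def IsAbsolutelyMinimumAttaining {E F : Type*} [NormedAddCommGroup E] [InnerProductSpace ℂ E]
    [NormedAddCommGroup F] [InnerProductSpace ℂ F] (T : E →L[ℂ] F) : Prop :=
  ∀ M : Submodule ℂ E, IsClosed (M : Set E) → M ≠ ⊥ → IsMinimumAttaining (T.comp M.subtypeL)

/-- A bounded operator has finite rank if its range is finite dimensional. -/
def IsFiniteRankOperator {E F : Type*} [NormedAddCommGroup E] [InnerProductSpace ℂ E]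
    [NormedAddCommGroup F] [InnerProductSpace ℂ F] (T : E →L[ℂ] F) : Prop :=
  FiniteDimensional ℂ (LinearMap.range (T : E →ₗ[ℂ] F))

/-- The triple `(α, K, F)` is a decomposition `T = α I - K + F` with `K` a positive compact
operator, `‖K‖ ≤ α`, `F` a positive finite rank operator, and `K F = F K = 0`. -/
structure IsAMDecomposition {H : Type*} [NormedAddCommGroup H] [InnerProductSpace ℂ H]
    (T : H →L[ℂ] H) (α : ℝ) (K F : H →L[ℂ] H) : Prop where
  eq : T = (α : ℂ) • ContinuousLinearMap.id ℂ H - K + F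
  posK : K.IsPositive
  compactK : IsCompactOperator K
  normK : ‖K‖ ≤ α
  posF : F.IsPositive
  finiteRankF : IsFiniteRankOperator F
  mulKF : K.comp F = 0
  mulFK : F.comp K = 0

/-! From (2) to (1): if `F` is injective on `M`, then `M` is finite-dimensional and its unit sphere
is compact. Otherwise some unit vector of `M` lies in `ker F`, so `m(T|_M) ≤ α`, and `S = T|_M`
satisfies `S*S = α² - C` with `C` compact. Either `m(S) = α` is attained there, or `m(S) < α` and
minimizing sequences subconverge.

From (1) to (2): a minimizer on an invariant subspace is an eigenvector, so Zorn yields an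
eigenbasis. Let `α` be the least level with infinitely many eigenvalues below every `t > α`. Only
finitely many eigenvalues exceed `α`, by the obstruction
`not_isAbsolutelyMinimumAttaining_of_orthonormal`. They give `F`; those below give `K`.

Uniqueness: the identity is not compact, which fixes `α`; then `F` and `K` are the positive and
negative parts of `T - αI`. -/

open ContinuousLinearMap InnerProductSpace Filter Topology

/-! ### Elementary facts on the minimum modulus. -/

section MinimumModulus

variable {E F : Type*} [NormedAddCommGroup E] [InnerProductSpace ℂ E]
  [NormedAddCommGroup F] [InnerProductSpace ℂ F]

theorem minimumModulus_le (S : E →L[ℂ] F) {x : E} (hx : ‖x‖ = 1) : minimumModulus S ≤ ‖S x‖ :=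
  csInf_le ⟨0, by rintro r ⟨y, -, rfl⟩; exact norm_nonneg _⟩ ⟨x, hx, rfl⟩

theorem minimumModulus_nonneg (S : E →L[ℂ] F) : 0 ≤ minimumModulus S :=
  Real.sInf_nonneg (by rintro r ⟨y, -, rfl⟩; exact norm_nonneg _)

theorem minimumModulus_mul_norm_le (S : E →L[ℂ] F) (x : E) :
    minimumModulus S * ‖x‖ ≤ ‖S x‖ := by
  rcases eq_or_ne x 0 with rfl | hx
  · simp
  have hx' : 0 < ‖x‖ := norm_pos_iff.2 hx
  have h := minimumModulus_le S (x := ((‖x‖⁻¹ : ℝ) : ℂ) • x) (by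
    rw [norm_smul, Complex.norm_real, norm_inv, norm_norm, inv_mul_cancel₀ hx'.ne'])
  rw [map_smul, norm_smul, Complex.norm_real, norm_inv, norm_norm] at h
  rwa [inv_mul_eq_div, le_div_iff₀ hx'] at h

theorem exists_norm_lt_of_minimumModulus_lt (S : E →L[ℂ] F) {x : E} (hx : ‖x‖ = 1) {r : ℝ}
    (hr : minimumModulus S < r) : ∃ y : E, ‖y‖ = 1 ∧ ‖S y‖ < r := by
  have hne : {r : ℝ | ∃ x : E, ‖x‖ = 1 ∧ r = ‖S x‖}.Nonempty := ⟨‖S x‖, x, hx, rfl⟩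
  obtain ⟨_, ⟨y, hy, rfl⟩, h⟩ := exists_lt_of_csInf_lt hne hr
  exact ⟨y, hy, h⟩

theorem isMinimumAttaining_of_finiteDimensional [FiniteDimensional ℂ E] [Nontrivial E]
    (S : E →L[ℂ] F) : IsMinimumAttaining S := by
  have : ProperSpace E := FiniteDimensional.proper ℂ E
  obtain ⟨x, hx⟩ := exists_norm_eq E zero_le_one
  obtain ⟨x₀, hx₀, hmin⟩ := (isCompact_sphere (0 : E) 1).exists_isMinOn
    ⟨x, by simpa using hx⟩ (f := fun x => ‖S x‖) (by fun_prop)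
  rw [mem_sphere_zero_iff_norm] at hx₀
  refine ⟨x₀, hx₀, le_antisymm (le_csInf ⟨_, x, hx, rfl⟩ ?_) (minimumModulus_le S hx₀)⟩
  rintro _ ⟨y, hy, rfl⟩
  exact hmin (by simpa using hy)

end MinimumModulus

/-! ### Positive operators and compact perturbations of scalars. -/

section Positive

variable {E F : Type*} [NormedAddCommGroup E] [InnerProductSpace ℂ E] [CompleteSpace E]
  [NormedAddCommGroup F] [InnerProductSpace ℂ F] [CompleteSpace F]

/-- Factor `A = S*S` and use `‖S‖² = ‖A‖`. A small quadratic form thus forces a small image. -/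
theorem ContinuousLinearMap.IsPositive.norm_apply_sq_le {A : E →L[ℂ] E} (hA : A.IsPositive)
    (x : E) : ‖A x‖ ^ 2 ≤ ‖A‖ * (inner ℂ (A x) x).re := by
  obtain ⟨S, rfl⟩ := CStarAlgebra.nonneg_iff_eq_star_mul_self.1 ((nonneg_iff_isPositive A).2 hA)
  have h : ‖S x‖ ^ 2 = (inner ℂ ((star S * S) x) x).re := apply_norm_sq_eq_inner_adjoint_left S x
  rw [← h, CStarRing.norm_star_mul_self, mul_apply_eq_comp, ← sq, ← mul_pow]
  refine pow_le_pow_left₀ (norm_nonneg _) ?_ 2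
  exact (le_opNorm _ _).trans_eq (by rw [norm_star])

theorem isPositive_adjoint_comp_self_sub_minimumModulus (S : E →L[ℂ] F) :
    (S.adjoint.comp S - ((minimumModulus S ^ 2 : ℝ) : ℂ) • ContinuousLinearMap.id ℂ E).IsPositive ∧
    ∀ x, (inner ℂ ((S.adjoint.comp S -
      ((minimumModulus S ^ 2 : ℝ) : ℂ) • ContinuousLinearMap.id ℂ E) x) x).re =
        ‖S x‖ ^ 2 - minimumModulus S ^ 2 * ‖x‖ ^ 2 := by
  have key : ∀ x, (inner ℂ ((S.adjoint.comp S -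
      ((minimumModulus S ^ 2 : ℝ) : ℂ) • ContinuousLinearMap.id ℂ E) x) x).re =
        ‖S x‖ ^ 2 - minimumModulus S ^ 2 * ‖x‖ ^ 2 := by
    intro x
    have h := apply_norm_sq_eq_inner_adjoint_left S x
    rw [sub_apply, inner_sub_left, Complex.sub_re, smul_apply, id_apply, inner_smul_left,
      Complex.conj_ofReal, Complex.re_ofReal_mul, h]
    congr 2
    exact (inner_self_eq_norm_sq (𝕜 := ℂ) x)
  refine ⟨⟨?_, fun x => ?_⟩, key⟩
  · rw [← isSelfAdjoint_iff_isSymmetric]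
    refine IsSelfAdjoint.sub (isPositive_adjoint_comp_self S).isSelfAdjoint ?_
    exact IsSelfAdjoint.smul (Complex.conj_ofReal _) (IsSelfAdjoint.one _)
  · refine (sub_nonneg.2 ?_).trans_eq (key x).symm
    rw [← mul_pow]
    exact pow_le_pow_left₀ (mul_nonneg (minimumModulus_nonneg S) (norm_nonneg x))
      (minimumModulus_mul_norm_le S x) 2

theorem adjoint_comp_self_apply_of_norm_eq_minimumModulus (S : E →L[ℂ] F) {x : E} (hx : ‖x‖ = 1)
    (h : ‖S x‖ = minimumModulus S) :
    S.adjoint (S x) = ((minimumModulus S ^ 2 : ℝ) : ℂ) • x := by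
  obtain ⟨hpos, hq⟩ := isPositive_adjoint_comp_self_sub_minimumModulus S
  have := hpos.norm_apply_sq_le x
  rw [hq, h, hx, one_pow, mul_one, sub_self, mul_zero] at this
  have h0 := norm_eq_zero.1 (pow_eq_zero_iff two_ne_zero |>.1 (le_antisymm this (sq_nonneg _)))
  exact sub_eq_zero.1 h0

/-- If `m < α`, then `m²` lies below the scalar part `α²`, and compactness of `C` extracts a limit
from a minimizing sequence. -/
theorem isMinimumAttaining_of_adjoint_comp_self_eq (S : E →L[ℂ] F) {α : ℝ}
    {C : E →L[ℂ] E} (hC : IsCompactOperator C)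
    (hS : S.adjoint.comp S = ((α ^ 2 : ℝ) : ℂ) • ContinuousLinearMap.id ℂ E - C)
    {x : E} (hx : ‖x‖ = 1) (hxα : ‖S x‖ ≤ α) : IsMinimumAttaining S := by
  obtain ⟨hpos, hq⟩ := isPositive_adjoint_comp_self_sub_minimumModulus S
  set m := minimumModulus S with hm
  have hm0 : 0 ≤ m := minimumModulus_nonneg S
  have hmα : m ≤ α := (minimumModulus_le S hx).trans hxα
  rcases hmα.eq_or_lt with hmα | hmα
  · exact ⟨x, hx, le_antisymm (hxα.trans_eq hmα.symm) (minimumModulus_le S hx)⟩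
  set B := S.adjoint.comp S - ((m ^ 2 : ℝ) : ℂ) • ContinuousLinearMap.id ℂ E with hB
  have hs : 0 < α ^ 2 - m ^ 2 := by nlinarith
  have hlt : ∀ n : ℕ, m < m + 1 / ((n : ℝ) + 1) := fun n => lt_add_of_pos_right _ (by positivity)
  choose u hu huS using fun n : ℕ => exists_norm_lt_of_minimumModulus_lt S hx (hlt n)
  have hlim : Tendsto (fun n => ‖S (u n)‖) atTop (𝓝 m) := by
    refine tendsto_of_tendsto_of_tendsto_of_le_of_le tendsto_const_nhds
      (by simpa using tendsto_one_div_add_atTop_nhds_zero_nat.const_add m)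
      (fun n => minimumModulus_le S (hu n)) fun n => (huS n).le
  have hBu : Tendsto (fun n => B (u n)) atTop (𝓝 0) := by
    have h1 : Tendsto (fun n => ‖B (u n)‖ ^ 2) atTop (𝓝 0) := by
      refine squeeze_zero (fun n => sq_nonneg _) (fun n => hpos.norm_apply_sq_le (u n)) ?_
      simp only [hq, hu, one_pow, mul_one]
      have h2 := ((hlim.pow 2).sub_const (m ^ 2)).const_mul ‖B‖
      rwa [sub_self, mul_zero] at h2
    rw [tendsto_zero_iff_norm_tendsto_zero]
    simpa using h1.sqrt
  obtain ⟨Q, hQ, hsub⟩ := hC.image_closedBall_subset_compact (f := (C : E →ₗ[ℂ] E)) 1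
  obtain ⟨y, -, φ, hφ, hy⟩ := hQ.tendsto_subseq (x := fun n => C (u n))
    fun n => hsub ⟨u n, by simp [hu], rfl⟩
  -- `B + C` is a nonzero scalar, so convergence of `B (u n)` and of a subsequence of `C (u n)`
  -- gives convergence of that subsequence of `u`.
  have hBC : ∀ z, z = (((α ^ 2 - m ^ 2)⁻¹ : ℝ) : ℂ) • (B z + C z) := by
    intro z
    have : B z + C z = ((α ^ 2 - m ^ 2 : ℝ) : ℂ) • z := by
      simp only [hB, hS, sub_apply, smul_apply, id_apply]
      push_cast
      module
    rw [this, smul_smul, ← Complex.ofReal_mul, inv_mul_cancel₀ hs.ne', Complex.ofReal_one, one_smul]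
  have hconv : Tendsto (fun n => u (φ n)) atTop (𝓝 ((((α ^ 2 - m ^ 2)⁻¹ : ℝ) : ℂ) • (0 + y))) := by
    refine (((hBu.comp hφ.tendsto_atTop).add hy).const_smul
      ((((α ^ 2 - m ^ 2)⁻¹ : ℝ) : ℂ))).congr fun n => ?_
    exact (hBC _).symm
  refine ⟨_, tendsto_nhds_unique hconv.norm (by simp [hu]), ?_⟩
  exact tendsto_nhds_unique ((S.continuous.tendsto _).comp hconv).norm
    (hlim.comp hφ.tendsto_atTop)

end Positive

/-! ### Uniqueness of the decomposition. -/

section Uniqueness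

variable {H : Type*} [NormedAddCommGroup H] [InnerProductSpace ℂ H]

theorem IsFiniteRankOperator.isCompactOperator {E F : Type*} [NormedAddCommGroup E]
    [InnerProductSpace ℂ E] [NormedAddCommGroup F] [InnerProductSpace ℂ F] {T : E →L[ℂ] F}
    (hT : IsFiniteRankOperator T) : IsCompactOperator T := by
  have : FiniteDimensional ℂ (LinearMap.range (T : E →ₗ[ℂ] F)) := hT
  have : LocallyCompactSpace (LinearMap.range (T : E →ₗ[ℂ] F)) :=
    have := FiniteDimensional.proper ℂ (LinearMap.range (T : E →ₗ[ℂ] F))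
    inferInstance
  let f : E →L[ℂ] LinearMap.range (T : E →ₗ[ℂ] F) := T.codRestrict _ fun x => ⟨x, rfl⟩
  exact (isCompactOperator_of_locallyCompactSpace_dom f).clm_comp (LinearMap.range (T : E →ₗ[ℂ] F)).subtypeL

theorem IsAMDecomposition.isCompactOperator_sub {T : H →L[ℂ] H} {α : ℝ} {K F : H →L[ℂ] H}
    (h : IsAMDecomposition T α K F) :
    IsCompactOperator (T - (α : ℂ) • ContinuousLinearMap.id ℂ H) := by
  have : T - (α : ℂ) • ContinuousLinearMap.id ℂ H = F - K := by rw [h.eq]; abel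
  rw [this]
  exact h.finiteRankF.isCompactOperator.sub h.compactK

theorem IsAMDecomposition.scalar_unique (hH : ¬ FiniteDimensional ℂ H) {T : H →L[ℂ] H}
    {α α' : ℝ} {K K' F F' : H →L[ℂ] H} (h : IsAMDecomposition T α K F)
    (h' : IsAMDecomposition T α' K' F') : α = α' := by
  by_contra hne
  have hne' : (α : ℂ) - α' ≠ 0 := sub_ne_zero.2 (by exact_mod_cast hne)
  have hc := (h'.isCompactOperator_sub.sub h.isCompactOperator_sub).smul (((α : ℂ) - α')⁻¹)
  have hid : (id : H → H) = (((α : ℂ) - α')⁻¹) • (⇑(T - (α' : ℂ) • ContinuousLinearMap.id ℂ H) -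
      ⇑(T - (α : ℂ) • ContinuousLinearMap.id ℂ H)) := by
    funext x
    simp only [Pi.smul_apply, Pi.sub_apply, sub_apply, smul_apply, id_apply, id]
    rw [sub_sub_sub_cancel_left, ← sub_smul, smul_smul, inv_mul_cancel₀ hne', one_smul]
  exact hH (FiniteDimensional.of_isCompactOperator_id (𝕜 := ℂ) (hid ▸ hc))

theorem IsAMDecomposition.unique [CompleteSpace H] (hH : ¬ FiniteDimensional ℂ H) {T : H →L[ℂ] H}
    {α α' : ℝ} {K K' F F' : H →L[ℂ] H} (h : IsAMDecomposition T α K F)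
    (h' : IsAMDecomposition T α' K' F') : α = α' ∧ K = K' ∧ F = F' := by
  obtain rfl := h.scalar_unique hH h'
  have key : ∀ {K F : H →L[ℂ] H}, IsAMDecomposition T α K F →
      (T - (α : ℂ) • ContinuousLinearMap.id ℂ H)⁺ = F ∧
      (T - (α : ℂ) • ContinuousLinearMap.id ℂ H)⁻ = K := fun {K F} h =>
    CFC.posPart_negPart_unique (by rw [h.eq]; abel) h.mulFK
      ((nonneg_iff_isPositive F).2 h.posF) ((nonneg_iff_isPositive K).2 h.posK)
  exact ⟨rfl, (key h).2.symm.trans (key h').2, (key h).1.symm.trans (key h').1⟩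

end Uniqueness

/-! ### Operators diagonal in a Hilbert basis. -/

section Diagonal

variable {ι E : Type*} [NormedAddCommGroup E] [InnerProductSpace ℂ E]

theorem HilbertBasis.hasSum_sq_norm_inner (b : HilbertBasis ι ℂ E) (x : E) :
    HasSum (fun i => ‖inner ℂ (b i) x‖ ^ 2) (‖x‖ ^ 2) := by
  have h := Complex.hasSum_re (b.hasSum_inner_mul_inner x x)
  have hx : (inner ℂ x x).re = ‖x‖ ^ 2 := inner_self_eq_norm_sq (𝕜 := ℂ) x
  rw [hx] at h
  convert h using 2 with i
  rw [← inner_conj_symm x, Complex.conj_mul', ← Complex.ofReal_pow, Complex.ofReal_re]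

theorem HilbertBasis.ext_inner (b : HilbertBasis ι ℂ E) {x y : E}
    (h : ∀ i, inner ℂ (b i) x = inner ℂ (b i) y) : x = y := by
  refine b.repr.injective ?_
  ext i
  simp [b.repr_apply_apply, h]

theorem HilbertBasis.ext_clm (b : HilbertBasis ι ℂ E) {A B : E →L[ℂ] E}
    (h : ∀ i, A (b i) = B (b i)) : A = B := by
  refine ContinuousLinearMap.ext_on
    (Submodule.dense_iff_topologicalClosure_eq_top.2 b.dense_span) ?_
  rintro _ ⟨i, rfl⟩
  exact h i

variable {A : E →L[ℂ] E} {b : HilbertBasis ι ℂ E} {d : ι → ℝ}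

theorem inner_apply_of_diagonal (hA : A.IsSymmetric) (hd : ∀ i, A (b i) = (d i : ℂ) • b i)
    (i : ι) (x : E) : inner ℂ (b i) (A x) = d i * inner ℂ (b i) x := by
  rw [← hA.apply_clm, hd, inner_smul_left, Complex.conj_ofReal]

theorem hasSum_re_inner_of_diagonal (hA : A.IsSymmetric) (hd : ∀ i, A (b i) = (d i : ℂ) • b i)
    (x : E) : HasSum (fun i => d i * ‖inner ℂ (b i) x‖ ^ 2) (inner ℂ (A x) x).re := by
  have h := Complex.hasSum_re (b.hasSum_inner_mul_inner (A x) x)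
  convert h using 2 with i
  rw [← inner_conj_symm (A x), inner_apply_of_diagonal hA hd, map_mul, Complex.conj_ofReal,
    mul_assoc, Complex.re_ofReal_mul, Complex.conj_mul', ← Complex.ofReal_pow, Complex.ofReal_re]

theorem isPositive_of_diagonal (hA : A.IsSymmetric) (hd : ∀ i, A (b i) = (d i : ℂ) • b i)
    (h0 : ∀ i, 0 ≤ d i) : A.IsPositive :=
  ⟨hA, fun x => (hasSum_re_inner_of_diagonal hA hd x).nonneg fun i =>
    mul_nonneg (h0 i) (sq_nonneg _)⟩

theorem opNorm_le_of_diagonal (hA : A.IsSymmetric) (hd : ∀ i, A (b i) = (d i : ℂ) • b i)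
    {c : ℝ} (hc : 0 ≤ c) (h : ∀ i, |d i| ≤ c) : ‖A‖ ≤ c := by
  refine A.opNorm_le_bound hc fun x => ?_
  refine le_of_sq_le_sq ?_ (by positivity)
  rw [mul_pow]
  refine hasSum_le (fun i => ?_) (b.hasSum_sq_norm_inner (A x))
    ((b.hasSum_sq_norm_inner x).mul_left (c ^ 2))
  rw [inner_apply_of_diagonal hA hd, norm_mul, mul_pow, Complex.norm_real]
  gcongr
  exact h i

/-- The operator that multiplies the basis vector `b i` by `d i` for `i ∈ s` and kills the others. -/
noncomputable def finiteDiagonal (b : HilbertBasis ι ℂ E) (s : Finset ι) (d : ι → ℝ) : E →L[ℂ] E :=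
  ∑ i ∈ s, (d i : ℂ) • rankOne ℂ (b i) (b i)

theorem finiteDiagonal_apply_basis [DecidableEq ι] (b : HilbertBasis ι ℂ E) (s : Finset ι)
    (d : ι → ℝ) (j : ι) :
    finiteDiagonal b s d (b j) = (((if j ∈ s then d j else 0 : ℝ)) : ℂ) • b j := by
  have h : ∀ i, inner ℂ (b i) (b j) = if i = j then (1 : ℂ) else 0 :=
    fun i => orthonormal_iff_ite.1 b.orthonormal i j
  simp [finiteDiagonal, sum_apply, h, ite_smul]

theorem isSymmetric_finiteDiagonal (b : HilbertBasis ι ℂ E) (s : Finset ι) (d : ι → ℝ) :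
    (finiteDiagonal b s d).IsSymmetric := by
  intro x y
  change inner ℂ (finiteDiagonal b s d x) y = inner ℂ x (finiteDiagonal b s d y)
  simp only [finiteDiagonal, sum_apply, sum_inner, inner_sum, smul_apply, inner_smul_left,
    inner_smul_right, Complex.conj_ofReal, inner_left_rankOne_apply, inner_right_rankOne_apply]

theorem isFiniteRankOperator_finiteDiagonal (b : HilbertBasis ι ℂ E) (s : Finset ι) (d : ι → ℝ) :
    IsFiniteRankOperator (finiteDiagonal b s d) := by
  have hfin : FiniteDimensional ℂ (Submodule.span ℂ (b '' (s : Set ι))) :=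
    FiniteDimensional.span_of_finite ℂ (s.finite_toSet.image _)
  refine Submodule.finiteDimensional_of_le (S₂ := Submodule.span ℂ (b '' (s : Set ι))) ?_
  rintro _ ⟨x, rfl⟩
  simp only [finiteDiagonal, coe_coe, sum_apply, smul_apply, rankOne_apply]
  exact Submodule.sum_mem _ fun i hi => Submodule.smul_mem _ _ (Submodule.smul_mem _ _
    (Submodule.subset_span ⟨i, hi, rfl⟩))

/-- Truncating to the entries larger than `1 / (n + 1)` leaves a finite rank operator within that
distance in norm. -/
theorem isCompactOperator_of_diagonal [CompleteSpace E] (hA : A.IsSymmetric)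
    (hd : ∀ i, A (b i) = (d i : ℂ) • b i) (h : ∀ ε > 0, {i | ε < |d i|}.Finite) :
    IsCompactOperator A := by
  classical
  let P : ℕ → E →L[ℂ] E := fun n =>
    finiteDiagonal b (h (1 / ((n : ℝ) + 1)) (by positivity)).toFinset d
  refine isCompactOperator_of_tendsto (l := atTop) (F := P) ?_ (Eventually.of_forall fun n =>
    (isFiniteRankOperator_finiteDiagonal b _ d).isCompactOperator)
  rw [tendsto_iff_norm_sub_tendsto_zero]
  refine squeeze_zero (fun _ => norm_nonneg _) (fun n => ?_) tendsto_one_div_add_atTop_nhds_zero_nat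
  rw [norm_sub_rev]
  refine opNorm_le_of_diagonal (b := b)
    (d := fun i => d i - if i ∈ (h (1 / ((n : ℝ) + 1)) (by positivity)).toFinset then d i else 0)
    (hA.sub (isSymmetric_finiteDiagonal b _ d)) (fun i => ?_) (by positivity) fun i => ?_
  · rw [sub_apply, hd, finiteDiagonal_apply_basis, Complex.ofReal_sub, sub_smul]
  · by_cases hi : 1 / ((n : ℝ) + 1) < |d i|
    · simp only [Set.Finite.mem_toFinset, Set.mem_ofPred_eq, hi, if_true, sub_self, abs_zero]
      positivity
    · simpa only [Set.Finite.mem_toFinset, Set.mem_ofPred_eq, hi, if_false, sub_zero] using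
        not_lt.1 hi

end Diagonal

/-! ### The obstruction, and the basis of eigenvectors. -/

section AbsolutelyMinimumAttaining

variable {H : Type*} [NormedAddCommGroup H] [InnerProductSpace ℂ H] [CompleteSpace H]

/-- On the closed span of `g`, `S*S` is diagonal with entries `t i`. A unit vector `x` has `‖S x‖² =
∑ t i |x i|² > a`, while the infimum of these values is `a`. -/
theorem not_isAbsolutelyMinimumAttaining_of_orthonormal {T : H →L[ℂ] H} {ι : Type*} [Nonempty ι]
    {g : ι → H} (hg : Orthonormal ℂ g) {t : ι → ℝ} {a : ℝ} (ht : ∀ i, a < t i)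
    (hinf : ∀ ε > 0, ∃ i, t i < a + ε) (hn : ∀ i, ‖T (g i)‖ ^ 2 = t i)
    (ho : ∀ i j, i ≠ j → inner ℂ (T (g i)) (T (g j)) = 0) :
    ¬ IsAbsolutelyMinimumAttaining T := by
  classical
  intro hT
  set N := (Submodule.span ℂ (Set.range g)).topologicalClosure with hN
  have hgN : ∀ i, g i ∈ N := fun i =>
    Submodule.le_topologicalClosure _ (Submodule.subset_span ⟨i, rfl⟩)
  have hNc : IsClosed (N : Set H) := Submodule.isClosed_topologicalClosure _
  have : CompleteSpace N := hNc.completeSpace_coe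
  have hNbot : N ≠ ⊥ := fun h => by
    obtain ⟨i⟩ := ‹Nonempty ι›
    exact hg.ne_zero i ((Submodule.mem_bot ℂ).1 (h ▸ hgN i))
  have hgo : Orthonormal ℂ (fun i => (⟨g i, hgN i⟩ : N)) := hg.codRestrict N hgN
  have hbot : (Submodule.span ℂ (Set.range fun i => (⟨g i, hgN i⟩ : N)))ᗮ = ⊥ := by
    rw [Submodule.eq_bot_iff]
    intro y hy
    have hy' : ∀ i, inner ℂ (g i) (y : H) = 0 := fun i =>
      (Submodule.mem_orthogonal _ _).1 hy _ (Submodule.subset_span ⟨i, rfl⟩)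
    have h1 : (y : H) ∈ (Submodule.span ℂ (Set.range g))ᗮ := by
      rw [Submodule.mem_orthogonal]
      intro u hu
      induction hu using Submodule.span_induction with
      | mem x hx => obtain ⟨i, rfl⟩ := hx; exact hy' i
      | zero => simp
      | add x y _ _ hx hy => rw [inner_add_left, hx, hy, add_zero]
      | smul c x _ hx => rw [inner_smul_left, hx, mul_zero]
    rw [← Submodule.orthogonal_closure] at h1
    have := (Submodule.mem_orthogonal _ _).1 h1 y y.2
    exact Subtype.ext (inner_self_eq_zero.1 this)
  let b : HilbertBasis ι ℂ N := HilbertBasis.mkOfOrthogonalEqBot hgo hbot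
  have hb : ∀ i, b i = ⟨g i, hgN i⟩ := fun i =>
    congrFun (HilbertBasis.coe_mkOfOrthogonalEqBot hgo hbot) i
  obtain ⟨x, hx, hxm⟩ := hT N hNc hNbot
  set S := T.comp N.subtypeL with hS
  have hSb : ∀ i, S (b i) = T (g i) := fun i => by rw [hb]; rfl
  have hdiag : ∀ i, (S.adjoint.comp S) (b i) = (t i : ℂ) • b i := by
    refine fun i => b.ext_inner fun j => ?_
    rw [comp_apply, adjoint_inner_right, hSb, hSb, inner_smul_right,
      orthonormal_iff_ite.1 b.orthonormal j i]
    split_ifs with h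
    · subst h
      rw [inner_self_eq_norm_sq_to_K, ← hn]
      simp
    · rw [ho j i h, mul_zero]
  have h1 := hasSum_re_inner_of_diagonal
    (isPositive_adjoint_comp_self S).isSymmetric hdiag x
  have h2 : (inner ℂ ((S.adjoint.comp S) x) x).re = ‖S x‖ ^ 2 :=
    (apply_norm_sq_eq_inner_adjoint_left S x).symm
  have h3 := h1.sub ((b.hasSum_sq_norm_inner x).mul_left a)
  have hle : ‖S x‖ ^ 2 ≤ a := by
    refine le_of_forall_pos_lt_add fun ε hε => ?_
    obtain ⟨i, hi⟩ := hinf ε hε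
    refine lt_of_le_of_lt ?_ hi
    rw [hxm, ← hn i, ← hSb]
    exact pow_le_pow_left₀ (minimumModulus_nonneg S)
      (minimumModulus_le S (b.orthonormal.1 i)) 2
  have hnn : ∀ i, 0 ≤ t i * ‖inner ℂ (b i) x‖ ^ 2 - a * ‖inner ℂ (b i) x‖ ^ 2 := fun i => by
    rw [← sub_mul]
    exact mul_nonneg (sub_nonneg.2 (ht i).le) (sq_nonneg _)
  rw [h2, hx, one_pow, mul_one] at h3
  have hzero : ‖S x‖ ^ 2 - a = 0 := le_antisymm (sub_nonpos.2 hle) (h3.nonneg hnn)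
  rw [hzero, hasSum_zero_iff_of_nonneg hnn] at h3
  have hx0 : x = 0 := b.ext_inner fun i => by
    have := congrFun h3 i
    simp only [Pi.zero_apply, ← sub_mul] at this
    rw [inner_zero_right]
    simpa [(sub_pos.2 (ht i)).ne'] using this
  simp [hx0] at hx

/-- A minimizer satisfies `T² x = m² x`, that is `(T + m)(T - m) x = 0`, and positivity of `T`
forces `T x = m x`. -/
theorem IsAbsolutelyMinimumAttaining.exists_eigenvector {T : H →L[ℂ] H}
    (hT : IsAbsolutelyMinimumAttaining T) (hpos : T.IsPositive) {N : Submodule ℂ H}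
    (hNc : IsClosed (N : Set H)) (hN : N ≠ ⊥) (hinv : ∀ x ∈ N, T x ∈ N) :
    ∃ x ∈ N, ‖x‖ = 1 ∧ ∃ c : ℝ, T x = (c : ℂ) • x := by
  have : CompleteSpace N := hNc.completeSpace_coe
  obtain ⟨x, hx, hxm⟩ := hT N hNc hN
  have h := adjoint_comp_self_apply_of_norm_eq_minimumModulus _ hx hxm
  set S := T.comp N.subtypeL with hS
  set m := minimumModulus S with hm
  -- The adjoint of `S` only sees `N`; invariance puts the difference in `N`, where it is orthogonal
  -- to everything.
  have hsq : T (T x) = ((m ^ 2 : ℝ) : ℂ) • (x : H) := by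
    have hz : T (T x) - ((m ^ 2 : ℝ) : ℂ) • (x : H) ∈ N :=
      N.sub_mem (hinv _ (hinv _ x.2)) (N.smul_mem _ x.2)
    have h1 : ∀ y : N, inner ℂ (y : H) (T (T x) - ((m ^ 2 : ℝ) : ℂ) • (x : H)) = 0 := by
      intro y
      have h2 := congrArg (fun z => inner ℂ y z) h
      simp only [adjoint_inner_right] at h2
      rw [inner_sub_right, ← hpos.inner_left_eq_inner_right, sub_eq_zero]
      exact h2
    exact sub_eq_zero.1 (inner_self_eq_zero.1 (h1 ⟨_, hz⟩))
  have hx' : ‖(x : H)‖ = 1 := hx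
  refine ⟨x, x.2, hx', m, ?_⟩
  have hy : T (T x - (m : ℂ) • (x : H)) = -(m : ℂ) • (T x - (m : ℂ) • (x : H)) := by
    rw [map_sub, map_smul, hsq, Complex.ofReal_pow]
    module
  have hnn := hpos.re_inner_nonneg_left (T x - (m : ℂ) • (x : H))
  rw [hy, neg_smul, inner_neg_left, inner_smul_left, Complex.conj_ofReal, map_neg,
    inner_self_eq_norm_sq_to_K] at hnn
  have hnn' : 0 ≤ -(m * ‖T x - (m : ℂ) • (x : H)‖ ^ 2) := by
    refine hnn.trans_eq (congrArg Neg.neg ?_)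
    change ((m : ℂ) * ((‖T x - (m : ℂ) • (x : H)‖ : ℝ) : ℂ) ^ 2).re = _
    rw [← Complex.ofReal_pow, Complex.re_ofReal_mul, Complex.ofReal_re]
  rcases (minimumModulus_nonneg S).eq_or_lt with h0 | h0
  · have h0' : m = 0 := h0.symm
    have : ‖T x‖ = m := hxm
    rw [h0'] at this ⊢
    simp [norm_eq_zero.1 this]
  · have : ‖T x - (m : ℂ) • (x : H)‖ ^ 2 ≤ 0 := by
      have h0' : 0 < m := h0
      by_contra hlt
      nlinarith [mul_pos h0' (not_le.1 hlt)]
    exact sub_eq_zero.1 (norm_eq_zero.1 (pow_eq_zero_iff two_ne_zero |>.1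
      (le_antisymm this (sq_nonneg _))))

theorem IsAbsolutelyMinimumAttaining.exists_hilbertBasis {T : H →L[ℂ] H}
    (hT : IsAbsolutelyMinimumAttaining T) (hpos : T.IsPositive) :
    ∃ (w : Set H) (b : HilbertBasis w ℂ H) (d : w → ℝ), ∀ i, T (b i) = (d i : ℂ) • b i := by
  classical
  obtain ⟨w, -, hw⟩ := zorn_subset_nonempty
    {s : Set H | Orthonormal ℂ (Subtype.val : s → H) ∧ ∀ x ∈ s, ∃ c : ℝ, T x = (c : ℂ) • x}
    (fun c hc cc _ => ⟨⋃₀ c, ⟨orthonormal_sUnion_of_directed cc.directedOn fun x xc => (hc xc).1,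
      fun x ⟨s, hs, hx⟩ => (hc hs).2 x hx⟩, fun _ => Set.subset_sUnion_of_mem⟩)
    ∅ ⟨orthonormal_empty ℂ H, by simp⟩
  obtain ⟨hwo, hwe⟩ := hw.prop
  -- The complement is invariant by symmetry of `T`; an eigenvector in it would enlarge the maximal
  -- set `w`.
  have hbot : (Submodule.span ℂ (Set.range (Subtype.val : w → H)))ᗮ = ⊥ := by
    by_contra hne
    rw [Subtype.range_coe] at hne
    obtain ⟨x, hxN, hx, c, hc⟩ := hT.exists_eigenvector hpos (Submodule.isClosed_orthogonal _) hne
      (by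
        intro x hx
        rw [Submodule.mem_orthogonal] at hx ⊢
        intro u hu
        rw [← hpos.inner_left_eq_inner_right]
        refine hx _ ?_
        induction hu using Submodule.span_induction with
        | mem y hy =>
          obtain ⟨c, hc⟩ := hwe y hy
          rw [hc]
          exact Submodule.smul_mem _ _ (Submodule.subset_span hy)
        | zero => simp
        | add y z _ _ hy hz => rw [map_add]; exact Submodule.add_mem _ hy hz
        | smul c y _ hy => rw [map_smul]; exact Submodule.smul_mem _ _ hy)
    have hxw : ∀ y ∈ w, inner ℂ y x = 0 := fun y hy =>
      (Submodule.mem_orthogonal _ _).1 hxN y (Submodule.subset_span hy)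
    have hmem : x ∈ w := by
      refine hw.le_of_ge (y := insert x w) ⟨?_, ?_⟩ (Set.subset_insert x w) (Set.mem_insert x w)
      · have hxw' : ∀ y ∈ w, inner ℂ x y = 0 := fun y hy => inner_eq_zero_symm.1 (hxw y hy)
        have hxx : inner ℂ x x = 1 := by rw [inner_self_eq_norm_sq_to_K, hx]; simp
        have hxn : x ∉ w := fun h => one_ne_zero (hxx.symm.trans (hxw x h))
        have hwo' := orthonormal_subtype_iff_ite.1 hwo
        rw [orthonormal_subtype_iff_ite]
        rintro y (rfl | hy) z (rfl | hz)
        · rw [hxx, if_pos rfl]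
        · rw [hxw' z hz, if_neg (ne_of_mem_of_not_mem hz hxn).symm]
        · rw [hxw y hy, if_neg (ne_of_mem_of_not_mem hy hxn)]
        · exact hwo' y hy z hz
      · rintro y (rfl | hy)
        exacts [⟨c, hc⟩, hwe y hy]
    have h0 := inner_self_eq_zero.1 (hxw x hmem)
    simp [h0] at hx
  choose d hd using fun i : w => hwe i i.2
  refine ⟨w, HilbertBasis.mkOfOrthogonalEqBot hwo hbot, d, fun i => ?_⟩
  rw [HilbertBasis.coe_mkOfOrthogonalEqBot]
  exact hd i

end AbsolutelyMinimumAttaining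

/-! ### Distribution of eigenvalues and the two implications. -/

section Structure

variable {H : Type*} [NormedAddCommGroup H] [InnerProductSpace ℂ H]

theorem inner_two_terms_of_orthonormal {ι κ : Type*} [DecidableEq κ] {b : ι → H}
    (hb : Orthonormal ℂ b) {p q : κ → ι} (hp : p.Injective) (hq : q.Injective)
    (hpq : ∀ m n, p m ≠ q n) (x y : κ → ℝ) (m n : κ) :
    inner ℂ ((x m : ℂ) • b (p m) + (y m : ℂ) • b (q m)) ((x n : ℂ) • b (p n) + (y n : ℂ) • b (q n))
      = if m = n then ((x m ^ 2 + y m ^ 2 : ℝ) : ℂ) else 0 := by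
  classical
  have h := orthonormal_iff_ite.1 hb
  simp only [inner_add_left, inner_add_right, inner_smul_left, inner_smul_right, h,
    Complex.conj_ofReal, hp.eq_iff, hq.eq_iff, hpq, (hpq _ _).symm, if_false, mul_zero, add_zero,
    zero_add]
  split_ifs with hmn
  · subst hmn
    push_cast
    ring
  · simp

variable [CompleteSpace H]

/-- Pair low eigenvectors with high ones. Mixing the two vectors of a pair tunes `‖T g‖²` to any
value in `(γ², β²]`, so it can approach `γ²` without reaching it. -/
theorem not_isAbsolutelyMinimumAttaining_of_infinite_of_infinite {T : H →L[ℂ] H} {ι : Type*}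
    {b : ι → H} (hb : Orthonormal ℂ b) {d : ι → ℝ} (hd : ∀ i, T (b i) = (d i : ℂ) • b i)
    (hd0 : ∀ i, 0 ≤ d i) {β γ : ℝ} (hγ0 : 0 ≤ γ) (hγβ : γ < β) (hγ : {i | d i < γ}.Infinite)
    (hβ : {i | β ≤ d i}.Infinite) : ¬ IsAbsolutelyMinimumAttaining T := by
  let p : ℕ → ι := fun n => hγ.natEmbedding _ n
  let q : ℕ → ι := fun n => hβ.natEmbedding _ n
  have hp : p.Injective := Subtype.val_injective.comp (hγ.natEmbedding _).injective
  have hq : q.Injective := Subtype.val_injective.comp (hβ.natEmbedding _).injective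
  have hdp : ∀ n, d (p n) < γ := fun n => (hγ.natEmbedding _ n).2
  have hdq : ∀ n, β ≤ d (q n) := fun n => (hβ.natEmbedding _ n).2
  have hpq : ∀ m n, p m ≠ q n := fun m n h =>
    absurd (hdq n) (not_le.2 (h ▸ (hdp m).trans hγβ))
  have hgap : 0 < β ^ 2 - γ ^ 2 := by nlinarith
  let t : ℕ → ℝ := fun n => γ ^ 2 + (β ^ 2 - γ ^ 2) * (1 / ((n : ℝ) + 1))
  have ht : ∀ n, γ ^ 2 < t n := fun n => lt_add_of_pos_right _ (by positivity)
  have ht' : ∀ n, t n ≤ β ^ 2 := fun n => by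
    have h1 : 1 / ((n : ℝ) + 1) ≤ 1 := by
      rw [div_le_one (by positivity)]
      linarith [n.cast_nonneg (α := ℝ)]
    have := mul_le_mul_of_nonneg_left h1 hgap.le
    simp only [t]
    linarith
  have hlim : Tendsto t atTop (𝓝 (γ ^ 2)) := by
    have := (tendsto_one_div_add_atTop_nhds_zero_nat (𝕜 := ℝ)).const_mul (β ^ 2 - γ ^ 2)
    have := this.const_add (γ ^ 2)
    rwa [mul_zero, add_zero] at this
  have hpγ : ∀ n, d (p n) ^ 2 < γ ^ 2 := fun n => by nlinarith [hd0 (p n), hdp n]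
  have hqβ : ∀ n, β ^ 2 ≤ d (q n) ^ 2 := fun n => by nlinarith [hdq n]
  have hden : ∀ n, 0 < d (q n) ^ 2 - d (p n) ^ 2 := fun n => by linarith [hpγ n, hqβ n]
  -- The weight of the high eigenvector that solves `(1 - s) d(p)² + s d(q)² = t`.
  let s : ℕ → ℝ := fun n => (t n - d (p n) ^ 2) / (d (q n) ^ 2 - d (p n) ^ 2)
  have hs0 : ∀ n, 0 ≤ s n := fun n => div_nonneg (by linarith [hpγ n, ht n]) (hden n).le
  have hs1 : ∀ n, s n ≤ 1 := fun n => by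
    rw [div_le_one (hden n)]
    linarith [ht' n, hqβ n]
  have hst : ∀ n, (1 - s n) * d (p n) ^ 2 + s n * d (q n) ^ 2 = t n := fun n => by
    have : s n * (d (q n) ^ 2 - d (p n) ^ 2) = t n - d (p n) ^ 2 := div_mul_cancel₀ _ (hden n).ne'
    linarith
  let x : ℕ → ℝ := fun n => √(1 - s n)
  let y : ℕ → ℝ := fun n => √(s n)
  have hx2 : ∀ n, x n ^ 2 = 1 - s n := fun n => Real.sq_sqrt (sub_nonneg.2 (hs1 n))
  have hy2 : ∀ n, y n ^ 2 = s n := fun n => Real.sq_sqrt (hs0 n)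
  let g : ℕ → H := fun n => (x n : ℂ) • b (p n) + (y n : ℂ) • b (q n)
  have hTg : ∀ n, T (g n) = ((x n * d (p n) : ℝ) : ℂ) • b (p n) +
      ((y n * d (q n) : ℝ) : ℂ) • b (q n) := fun n => by
    simp only [g, map_add, map_smul, hd, smul_smul, Complex.ofReal_mul]
  have hTgg : ∀ m n, inner ℂ (T (g m)) (T (g n)) = if m = n then (t m : ℂ) else 0 := fun m n => by
    rw [hTg, hTg, inner_two_terms_of_orthonormal hb hp hq hpq (fun n => x n * d (p n))
      (fun n => y n * d (q n)), ← hst, mul_pow, mul_pow, hx2, hy2]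
  refine not_isAbsolutelyMinimumAttaining_of_orthonormal (g := g) (t := t) (a := γ ^ 2) ?_ ht
    (fun ε hε => (hlim.eventually (gt_mem_nhds (lt_add_of_pos_right _ hε))).exists) (fun n => ?_)
    fun m n hmn => by rw [hTgg, if_neg hmn]
  · rw [orthonormal_iff_ite]
    intro m n
    rw [inner_two_terms_of_orthonormal hb hp hq hpq x y, hx2, hy2, sub_add_cancel,
      Complex.ofReal_one]
  · have h := hTgg n n
    rw [if_pos rfl, inner_self_eq_norm_sq_to_K] at h
    have h' : ((‖T (g n)‖ ^ 2 : ℝ) : ℂ) = (t n : ℂ) := (Complex.ofReal_pow _ _).trans h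
    exact Complex.ofReal_injective h'

theorem IsAbsolutelyMinimumAttaining.finite_setOf_lt {T : H →L[ℂ] H}
    (hT : IsAbsolutelyMinimumAttaining T) {ι : Type*} {b : ι → H} (hb : Orthonormal ℂ b)
    {d : ι → ℝ} (hd : ∀ i, T (b i) = (d i : ℂ) • b i) (hd0 : ∀ i, 0 ≤ d i) {α : ℝ} (hα : 0 ≤ α)
    (h : ∀ t > α, {i | d i < t}.Infinite) : {i | α < d i}.Finite := by
  by_contra hinf
  -- Either infinitely many eigenvalues stay away from `α`, and pairing applies, or those above `α`
  -- decrease to `α` and their eigenvectors are already an obstruction.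
  by_cases hc : ∃ β > α, {i | β ≤ d i}.Infinite
  · obtain ⟨β, hβ, hβi⟩ := hc
    exact not_isAbsolutelyMinimumAttaining_of_infinite_of_infinite hb hd hd0
      (γ := (α + β) / 2) (by linarith) (by linarith) (h _ (by linarith)) hβi hT
  · push Not at hc
    have hne : ∀ β > α, ∃ i, α < d i ∧ d i < β := fun β hβ => by
      obtain ⟨i, hi, hi'⟩ := (Set.Infinite.sdiff hinf (hc β hβ)).nonempty
      exact ⟨i, hi, not_le.1 hi'⟩
    obtain ⟨i₀, hi₀, -⟩ := hne (α + 1) (by linarith)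
    have : Nonempty {i // α < d i} := ⟨⟨i₀, hi₀⟩⟩
    refine not_isAbsolutelyMinimumAttaining_of_orthonormal
      (g := fun i : {i // α < d i} => b i) (t := fun i => d i ^ 2) (a := α ^ 2)
      (hb.comp _ Subtype.val_injective) (fun i => pow_lt_pow_left₀ i.2 hα two_ne_zero)
      (fun ε hε => ?_) (fun i => ?_) (fun i j hij => ?_) hT
    · obtain ⟨i, hi, hi'⟩ := hne (√(α ^ 2 + ε)) (Real.lt_sqrt_of_sq_lt (by linarith))
      exact ⟨⟨i, hi⟩, (Real.lt_sqrt (hd0 i)).1 hi'⟩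
    · rw [hd, norm_smul, hb.1, mul_one, Complex.norm_real, Real.norm_eq_abs, sq_abs]
    · rw [hd, hd, inner_smul_left, inner_smul_right,
        hb.2 (Subtype.val_injective.ne hij), mul_zero, mul_zero]

theorem IsAbsolutelyMinimumAttaining.exists_isAMDecomposition (hH : ¬ FiniteDimensional ℂ H)
    {T : H →L[ℂ] H} (hT : IsAbsolutelyMinimumAttaining T) (hpos : T.IsPositive) :
    ∃ (α : ℝ) (K F : H →L[ℂ] H), IsAMDecomposition T α K F := by
  classical
  obtain ⟨w, b, d, hd⟩ := hT.exists_hilbertBasis hpos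
  have hb := b.orthonormal
  have hd0 : ∀ i, 0 ≤ d i := fun i => by
    have h := hpos.re_inner_nonneg_right (b i)
    rwa [hd, inner_smul_right, inner_self_eq_norm_sq_to_K, hb.1, RCLike.ofReal_one, one_pow,
      mul_one] at h
  have hdT : ∀ i, d i ≤ ‖T‖ := fun i => by
    have h := T.le_opNorm (b i)
    rw [hd, norm_smul, hb.1, mul_one, mul_one, Complex.norm_real] at h
    exact (le_abs_self _).trans h
  have hw : Infinite w := by
    by_contra hfin
    have := not_infinite_iff_finite.1 hfin
    have := Fintype.ofFinite w
    exact hH b.toOrthonormalBasis.toBasis.finiteDimensional_of_finite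
  let U : Set ℝ := {t | {i | d i < t}.Infinite}
  have hU0 : ∀ t ∈ U, 0 ≤ t := fun t ht => by
    obtain ⟨i, hi⟩ := Set.Infinite.nonempty ht
    exact (hd0 i).trans (le_of_lt hi)
  have hUne : U.Nonempty := ⟨‖T‖ + 1, by
    have : {i | d i < ‖T‖ + 1} = Set.univ := Set.eq_univ_of_forall fun i => by
      exact lt_of_le_of_lt (hdT i) (lt_add_one _)
    change Set.Infinite _
    rw [this]
    exact Set.infinite_univ⟩
  set α := sInf U with hαdef
  have hα : 0 ≤ α := le_csInf hUne hU0
  have habove : ∀ t > α, {i | d i < t}.Infinite := fun t ht => by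
    obtain ⟨s, hs, hst⟩ := exists_lt_of_csInf_lt hUne ht
    exact Set.Infinite.mono (fun i hi => lt_trans hi hst) hs
  have hbelow : ∀ t < α, {i | d i < t}.Finite := fun t ht => by
    by_contra h
    exact absurd (csInf_le ⟨0, hU0⟩ (a := t) h) (not_le.2 ht)
  have hfin := hT.finite_setOf_lt hb hd hd0 hα habove
  set F := finiteDiagonal b hfin.toFinset (fun i => d i - α) with hF
  have hFd : ∀ i, F (b i) = ((max (d i - α) 0 : ℝ) : ℂ) • b i := fun i => by
    rw [hF, finiteDiagonal_apply_basis]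
    congr 2
    by_cases hi : α < d i
    · rw [if_pos (by simpa using hi), max_eq_left (sub_nonneg.2 hi.le)]
    · rw [if_neg (by simpa using hi), max_eq_right (sub_nonpos.2 (not_lt.1 hi))]
  have hFs : F.IsSymmetric := isSymmetric_finiteDiagonal b _ _
  -- With this choice the required identity is automatic, and `K` is diagonal with entries `(α - d
  -- i)⁺`.
  set K := (α : ℂ) • ContinuousLinearMap.id ℂ H - T + F with hK
  have hKd : ∀ i, K (b i) = ((max (α - d i) 0 : ℝ) : ℂ) • b i := fun i => by
    rw [hK, add_apply, sub_apply, hd, hFd, smul_apply, id_apply, ← sub_smul, ← add_smul,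
      ← Complex.ofReal_sub, ← Complex.ofReal_add]
    congr 2
    rcases le_total α (d i) with h | h
    · rw [max_eq_left (sub_nonneg.2 h), max_eq_right (sub_nonpos.2 h)]
      ring
    · rw [max_eq_right (sub_nonpos.2 h), max_eq_left (sub_nonneg.2 h), add_zero]
  have hKs : K.IsSymmetric := by
    rw [← isSelfAdjoint_iff_isSymmetric]
    refine IsSelfAdjoint.add (IsSelfAdjoint.sub ?_ hpos.isSelfAdjoint) hFs.isSelfAdjoint
    exact IsSelfAdjoint.smul (Complex.conj_ofReal _) (IsSelfAdjoint.one _)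
  have hmul : ∀ i, max (α - d i) 0 * max (d i - α) 0 = 0 := fun i => by
    rcases le_total α (d i) with h | h
    · rw [max_eq_right (sub_nonpos.2 h), zero_mul]
    · rw [max_eq_right (sub_nonpos.2 h), mul_zero]
  refine ⟨α, K, F, ⟨by rw [hK]; abel, isPositive_of_diagonal hKs hKd fun i => le_max_right _ _,
    isCompactOperator_of_diagonal hKs hKd fun ε hε => ?_, opNorm_le_of_diagonal hKs hKd hα
    fun i => ?_, isPositive_of_diagonal hFs hFd fun i => le_max_right _ _,
    isFiniteRankOperator_finiteDiagonal b _ _, b.ext_clm fun i => ?_, b.ext_clm fun i => ?_⟩⟩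
  -- Entries of `K` above `ε` come from eigenvalues below `α - ε`, finite in number by minimality of
  -- `α`.
  · refine (hbelow (α - ε) (by linarith)).subset fun i hi => ?_
    rw [Set.mem_ofPred_eq, abs_of_nonneg (le_max_right _ _), lt_max_iff] at hi
    rcases hi with hi | hi
    · exact lt_sub_comm.1 hi
    · exact absurd hi (not_lt.2 hε.le)
  · rw [abs_of_nonneg (le_max_right _ _)]
    exact max_le (by linarith [hd0 i]) hα
  · rw [comp_apply, hFd, map_smul, hKd, smul_smul, ← Complex.ofReal_mul, mul_comm, hmul]
    simp
  · rw [comp_apply, hKd, map_smul, hFd, smul_smul, ← Complex.ofReal_mul, hmul]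
    simp

theorem IsAMDecomposition.isPositive {T : H →L[ℂ] H} {α : ℝ} {K F : H →L[ℂ] H}
    (h : IsAMDecomposition T α K F) : T.IsPositive := by
  rw [h.eq]
  refine IsPositive.add ⟨?_, fun x => ?_⟩ h.posF
  · rw [← isSelfAdjoint_iff_isSymmetric]
    refine IsSelfAdjoint.sub ?_ h.posK.isSelfAdjoint
    exact IsSelfAdjoint.smul (Complex.conj_ofReal _) (IsSelfAdjoint.one _)
  · change 0 ≤ (inner ℂ _ x).re
    have hxx : (inner ℂ x x).re = ‖x‖ ^ 2 := inner_self_eq_norm_sq (𝕜 := ℂ) x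
    have h1 : (inner ℂ (K x) x).re ≤ ‖K x‖ * ‖x‖ := re_inner_le_norm (𝕜 := ℂ) _ _
    have h2 : ‖K x‖ ≤ α * ‖x‖ := K.le_of_opNorm_le h.normK x
    rw [sub_apply, smul_apply, id_apply, inner_sub_left, inner_smul_left, Complex.conj_ofReal,
      Complex.sub_re, Complex.re_ofReal_mul, hxx]
    nlinarith [norm_nonneg x]

/-- On `ker F`, `T` acts as `α - K`. Expanding the square, `‖K x‖² ≤ α ⟨K x, x⟩` is absorbed by the
cross term `-2α ⟨K x, x⟩`. -/
theorem IsAMDecomposition.norm_apply_le {T : H →L[ℂ] H} {α : ℝ} {K F : H →L[ℂ] H}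
    (h : IsAMDecomposition T α K F) {x : H} (hx : F x = 0) : ‖T x‖ ≤ α * ‖x‖ := by
  have hα : 0 ≤ α := (norm_nonneg K).trans h.normK
  refine le_of_sq_le_sq ?_ (by positivity)
  have hT : T x = (α : ℂ) • x - K x := by
    rw [h.eq, add_apply, hx, add_zero, sub_apply, smul_apply, id_apply]
  have h1 := h.posK.norm_apply_sq_le x
  have h2 : 0 ≤ (inner ℂ (K x) x).re := h.posK.re_inner_nonneg_left x
  have h3 : ‖(α : ℂ) • x - K x‖ ^ 2 =
      ‖(α : ℂ) • x‖ ^ 2 - 2 * (inner ℂ ((α : ℂ) • x) (K x)).re + ‖K x‖ ^ 2 :=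
    norm_sub_sq (𝕜 := ℂ) _ _
  rw [inner_smul_left, Complex.conj_ofReal, Complex.re_ofReal_mul,
    ← h.posK.inner_left_eq_inner_right, norm_smul, Complex.norm_real, Real.norm_eq_abs,
    abs_of_nonneg hα] at h3
  rw [hT, h3]
  nlinarith [mul_le_mul_of_nonneg_right h.normK h2, mul_nonneg hα h2]

theorem IsAMDecomposition.isAbsolutelyMinimumAttaining {T : H →L[ℂ] H} {α : ℝ} {K F : H →L[ℂ] H}
    (h : IsAMDecomposition T α K F) : IsAbsolutelyMinimumAttaining T := by
  intro M hM hne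
  have : CompleteSpace M := hM.completeSpace_coe
  have : Nontrivial M := (Submodule.nontrivial_iff_ne_bot).2 hne
  have : FiniteDimensional ℂ (LinearMap.range (F : H →ₗ[ℂ] H)) := h.finiteRankF
  by_cases hker : ∀ x : M, F x = 0 → x = 0
  · have hinj : Function.Injective
        (((F : H →ₗ[ℂ] H).rangeRestrict).comp M.subtype) := by
      rw [injective_iff_map_eq_zero]
      exact fun x hx => hker x (congrArg Subtype.val hx)
    have : FiniteDimensional ℂ M := FiniteDimensional.of_injective _ hinj
    exact isMinimumAttaining_of_finiteDimensional _
  · push Not at hker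
    obtain ⟨x, hFx, hx⟩ := hker
    have hx' : ‖x‖ ≠ 0 := norm_ne_zero_iff.2 hx
    set G := T - (α : ℂ) • ContinuousLinearMap.id ℂ H with hG
    have hT : T = (α : ℂ) • ContinuousLinearMap.id ℂ H + G := by rw [hG]; abel
    -- From `T = α + G` with `G` compact, `T² = α² + (2αG + G²)`.
    have hGc : IsCompactOperator (-((2 * α : ℂ) • G + G.comp G)) :=
      ((h.isCompactOperator_sub.smul (2 * α : ℂ)).add (h.isCompactOperator_sub.comp_clm G)).neg
    refine isMinimumAttaining_of_adjoint_comp_self_eq (α := α) _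
      ((hGc.comp_clm M.subtypeL).clm_comp M.subtypeL.adjoint)
      (C := M.subtypeL.adjoint.comp ((-((2 * α : ℂ) • G + G.comp G)).comp M.subtypeL)) ?_
      (x := ((‖x‖⁻¹ : ℝ) : ℂ) • x) ?_ ?_
    · have hTT : T.adjoint.comp T = ((α ^ 2 : ℝ) : ℂ) • ContinuousLinearMap.id ℂ H -
          (-((2 * α : ℂ) • G + G.comp G)) := by
        rw [h.isPositive.isSelfAdjoint.adjoint_eq]
        ext z
        nth_rewrite 1 [hT]
        nth_rewrite 1 [hT]
        simp only [comp_apply, add_apply, sub_apply, neg_apply, smul_apply, id_apply, map_add,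
          map_smul]
        push_cast
        module
      have hid : M.subtypeL.adjoint.comp M.subtypeL = ContinuousLinearMap.id ℂ M := by
        ext z
        simp [Submodule.adjoint_subtypeL]
      rw [adjoint_comp, comp_assoc, ← comp_assoc (T.adjoint), hTT, sub_comp, comp_sub, smul_comp,
        comp_smul, id_comp, hid]
    · rw [norm_smul, Complex.norm_real, norm_inv, norm_norm, inv_mul_cancel₀ hx']
    · have h1 := h.norm_apply_le hFx
      rw [map_smul, norm_smul, Complex.norm_real, norm_inv, norm_norm,
        inv_mul_le_iff₀ (by positivity), mul_comm]
      exact h1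

end Structure

theorem mainTheorem1 {H : Type*} [NormedAddCommGroup H] [InnerProductSpace ℂ H] [CompleteSpace H]
    (hH : ¬ FiniteDimensional ℂ H) (T : H →L[ℂ] H) :
    ((T.IsPositive ∧ IsAbsolutelyMinimumAttaining T) ↔
      ∃ (α : ℝ) (K F : H →L[ℂ] H), IsAMDecomposition T α K F) ∧
    (∀ (α α' : ℝ) (K K' F F' : H →L[ℂ] H),
      IsAMDecomposition T α K F → IsAMDecomposition T α' K' F' →
        α = α' ∧ K = K' ∧ F = F') :=
  ⟨⟨fun h => h.2.exists_isAMDecomposition hH h.1,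
    fun ⟨_, _, _, h⟩ => ⟨h.isPositive, h.isAbsolutelyMinimumAttaining⟩⟩,
    fun _ _ _ _ _ _ h h' => h.unique hH h'⟩
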